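/- All graphs are simple. $\mathcal G_*$ is the space of rooted connected locally finite graphs up to root-preserving isomorphism, with the distance $d_{loc}(G_1,G_2)=2^{-\sup\{r:\,B_r(G_1)\cong B_r(G_2)\}}$, where $B_r(G)$ is the rooted subgraph induced on the vertices at distance at most $r$ from the root. For finite non-empty graphs $G_n$ and a random element $G^*$ of $\mathcal G_*$ (Borel law $\mu$, root $r^*$), write $G_n\to G^*$ ("$G^*$ is the local weak limit of $(G_n)$") if $\mathbb E f(G_n,v^*)\to\mathbb E f(G^*)$ for every bounded continuous $f:\mathcal G_*\to\mathbb R$, where $v^*$ is a uniformly random vertex of $G_n$ and $(G_n,v^*)$ stands for the component of $v^*$ rooted at $v^*$. Let $d_n$ be the degree of a uniformly random vertex of $G_n$ and $d^*$ the degree of $r^*$ in $G^*$. Let $\mathrm{emb}(H,G)$ be the number of injective homomorphisms from $H$ to $G$, and, for a rooted graph $H'$, let $\mathrm{emb}'(H',G,v)$ be the number of those that map the root of $H'$ to $v$. For an integer $h\ge 2$ consider the conditions (i) $\mathbb E\, d_n^{h-1}\to\mathbb E\,(d^*)^{h-1}$; (ii) $(d_n^{h-1})_n$ is uniformly integrable,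 i.e. $\sup_n\mathbb E\, d_n^{h-1}\mathbb I_{d_n^{h-1}>a}\to0$ as $a\to\infty$; (iii) for every connected graph $H$ on $h$ vertices and each of its $h$ rootings $H'$, $|V(G_n)|^{-1}\mathrm{emb}(H,G_n)\to\mathbb E\,\mathrm{emb}'(H',G^*,r^*)$. Let $G_n\to G^*$ and let $S_n\subseteq V(G_n)$ with $|S_n|=o(|V(G_n)|)$. (a) Suppose that $(d_n)_n$ is uniformly integrable and that $G_n'$ is obtained from $G_n$ by removing edges that have at least one endpoint in $S_n$ and adding edges that have both endpoints in $S_n$. Then $G_n'\to G^*$. (b) Let $h\ge2$, suppose that $|V(G_n)|=n$ for $n\ge1$, that $\mathbb E\,(d^*)^{h-1}<\infty$ and that $|S_n|=\Omega(n^{1/h})$, and let $G_n'$ be obtained from $G_n$ by merging the edges of a clique on $S_n$ into $G_n$ (that is, by joining all pairs of distinct vertices of $S_n$). Then $G_n'\to G^*$, but none of (i), (ii), (iii) holds for $G_n'$. -/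

import Mathlib

open MeasureTheory Filter Topology
open scoped ENNReal BoundedContinuousFunction

namespace LocalLimit

/-! ### Rooted graphs and the local distance -/

/-- Two rooted graphs `(G, v)` and `(H, w)` (on arbitrary vertex types) are isomorphic if there is
a graph isomorphism that maps the root to the root. -/
def RootedIso {V W : Type} (G : SimpleGraph V) (v : V) (H : SimpleGraph W) (w : W) : Prop :=
  ∃ φ : G ≃g H, φ v = w

/-- A rooted connected locally finite graph. -/
structure RootedGraph where
  Vert : Type
  graph : SimpleGraph Vert
  root : Vert
  connected : graph.Connected
  locallyFinite : ∀ v, (graph.neighborSet v).Finite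

namespace RootedGraph

/-- Root preserving isomorphism. -/
def Iso (G H : RootedGraph) : Prop := RootedIso G.graph G.root H.graph H.root

lemma Iso.refl (G : RootedGraph) : G.Iso G := ⟨RelIso.refl _, rfl⟩

lemma Iso.symm {G H : RootedGraph} : G.Iso H → H.Iso G := by
  rintro ⟨φ, hφ⟩
  exact ⟨φ.symm, by rw [← hφ]; exact φ.symm_apply_apply _⟩

lemma Iso.trans {G H K : RootedGraph} : G.Iso H → H.Iso K → G.Iso K := by
  rintro ⟨φ, hφ⟩ ⟨ψ, hψ⟩
  exact ⟨φ.trans ψ, by rw [← hψ, ← hφ]; rfl⟩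

/-- The vertices at distance at most `r` from the root (the graph is connected, so the
graph distance has no junk values). -/
def ballSet (G : RootedGraph) (r : ℕ) : Set G.Vert := {v | G.graph.dist G.root v ≤ r}

lemma root_mem_ballSet (G : RootedGraph) (r : ℕ) : G.root ∈ G.ballSet r := by
  simp [ballSet]

/-- `B_r(G) ≅ B_r(H)`: the rooted subgraphs induced on the vertices at distance at most `r` from
the root are isomorphic. -/
def BallIso (r : ℕ) (G H : RootedGraph) : Prop :=
  RootedIso (G.graph.induce (G.ballSet r)) ⟨G.root, G.root_mem_ballSet r⟩
    (H.graph.induce (H.ballSet r)) ⟨H.root, H.root_mem_ballSet r⟩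

lemma BallIso.refl (r : ℕ) (G : RootedGraph) : BallIso r G G := ⟨RelIso.refl _, rfl⟩

lemma BallIso.symm {r : ℕ} {G H : RootedGraph} : BallIso r G H → BallIso r H G := by
  rintro ⟨φ, hφ⟩
  exact ⟨φ.symm, by rw [← hφ]; exact φ.symm_apply_apply _⟩

lemma BallIso.trans {r : ℕ} {G H K : RootedGraph} :
    BallIso r G H → BallIso r H K → BallIso r G K := by
  rintro ⟨φ, hφ⟩ ⟨ψ, hψ⟩
  exact ⟨φ.trans ψ, by rw [← hψ, ← hφ]; rfl⟩

/-- In a connected graph a vertex at distance `k + 1` from the root has a neighbour at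
distance `k`. -/
lemma exists_adj_dist (G : RootedGraph) {u : G.Vert} {k : ℕ}
    (h : G.graph.dist G.root u = k + 1) :
    ∃ w, G.graph.Adj w u ∧ G.graph.dist G.root w = k := by
  obtain ⟨p, hp⟩ := G.connected.exists_walk_length_eq_dist u G.root
  rw [SimpleGraph.dist_comm, h] at hp
  cases p with
  | nil => simp at hp
  | @cons _ w _ hadj q =>
    refine ⟨w, hadj.symm, ?_⟩
    have h1 : q.length = k := by simpa using hp
    have h2 : G.graph.dist w G.root ≤ k := h1 ▸ SimpleGraph.dist_le q
    rw [SimpleGraph.dist_comm] at h2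
    have h3 := G.connected.dist_triangle (u := G.root) (v := w) (w := u)
    rw [h, SimpleGraph.dist_eq_one_iff_adj.mpr hadj.symm] at h3
    omega

/-- A root preserving isomorphism of balls does not increase the distance from the root. -/
lemma dist_map_le {r : ℕ} {G H : RootedGraph}
    (φ : G.graph.induce (G.ballSet r) ≃g H.graph.induce (H.ballSet r))
    (hφ : φ ⟨G.root, G.root_mem_ballSet r⟩ = ⟨H.root, H.root_mem_ballSet r⟩) :
    ∀ (k : ℕ) (u : G.ballSet r), G.graph.dist G.root u = k →
      H.graph.dist H.root (φ u) ≤ k := by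
  intro k
  induction k with
  | zero =>
    intro u hu
    have h0 : G.root = u := (G.connected.dist_eq_zero_iff).mp hu
    have h1 : u = ⟨G.root, G.root_mem_ballSet r⟩ := Subtype.ext h0.symm
    rw [h1, hφ]
    simp
  | succ k ih =>
    intro u hu
    obtain ⟨w, hw, hk⟩ := G.exists_adj_dist hu
    have hur : G.graph.dist G.root u ≤ r := u.2
    have hwr : w ∈ G.ballSet r := by
      change G.graph.dist G.root w ≤ r
      omega
    have h1 := ih ⟨w, hwr⟩ hk
    have h2 : (G.graph.induce (G.ballSet r)).Adj ⟨w, hwr⟩ u := hw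
    have h3 : H.graph.Adj (φ ⟨w, hwr⟩ : H.Vert) (φ u : H.Vert) := φ.map_adj_iff.mpr h2
    have h4 := H.connected.dist_triangle (u := H.root) (v := (φ ⟨w, hwr⟩ : H.Vert))
      (w := (φ u : H.Vert))
    rw [SimpleGraph.dist_eq_one_iff_adj.mpr h3] at h4
    omega

/-- If the balls of radius `r` are isomorphic, so are the balls of a smaller radius `s`. -/
lemma BallIso.mono {r s : ℕ} (hs : s ≤ r) {G H : RootedGraph} (h : BallIso r G H) :
    BallIso s G H := by
  obtain ⟨φ, hφ⟩ := h
  have hφ' : φ.symm ⟨H.root, H.root_mem_ballSet r⟩ = ⟨G.root, G.root_mem_ballSet r⟩ := by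
    rw [← hφ]; exact φ.symm_apply_apply _
  have hG : ∀ u : G.ballSet s, (u : G.Vert) ∈ G.ballSet r := fun u => le_trans u.2 hs
  have hH : ∀ u : H.ballSet s, (u : H.Vert) ∈ H.ballSet r := fun u => le_trans u.2 hs
  refine ⟨⟨⟨fun u => ⟨(φ ⟨u, hG u⟩ : H.Vert), (dist_map_le φ hφ _ ⟨u, hG u⟩ rfl).trans u.2⟩,
    fun u => ⟨(φ.symm ⟨u, hH u⟩ : G.Vert),
      (dist_map_le φ.symm hφ' _ ⟨u, hH u⟩ rfl).trans u.2⟩, ?_, ?_⟩, ?_⟩, ?_⟩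
  · intro u
    apply Subtype.ext
    have h1 := congrArg Subtype.val (φ.symm_apply_apply ⟨(u : G.Vert), hG u⟩)
    exact h1
  · intro u
    apply Subtype.ext
    have h1 := congrArg Subtype.val (φ.apply_symm_apply ⟨(u : H.Vert), hH u⟩)
    exact h1
  · intro u v
    exact φ.map_adj_iff (v := ⟨u, hG u⟩) (w := ⟨v, hG v⟩)
  · apply Subtype.ext
    have h1 := congrArg Subtype.val hφ
    exact h1

lemma Iso.dist_le {G H : RootedGraph} (φ : G.graph ≃g H.graph) (hφ : φ G.root = H.root)
    (u : G.Vert) : H.graph.dist H.root (φ u) ≤ G.graph.dist G.root u := by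
  obtain ⟨p, hp⟩ := G.connected.exists_walk_length_eq_dist G.root u
  have h := SimpleGraph.dist_le (p.map φ.toHom)
  rw [SimpleGraph.Walk.length_map, hp] at h
  have h' : H.graph.dist (φ G.root) (φ u) ≤ G.graph.dist G.root u := h
  rwa [hφ] at h'

lemma Iso.ballIso {G H : RootedGraph} (h : G.Iso H) (r : ℕ) : BallIso r G H := by
  obtain ⟨φ, hφ⟩ := h
  have hφ' : φ.symm H.root = G.root := by rw [← hφ]; exact φ.symm_apply_apply _
  refine ⟨⟨⟨fun u => ⟨φ u, (Iso.dist_le φ hφ u).trans u.2⟩,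
    fun u => ⟨φ.symm u, (Iso.dist_le φ.symm hφ' u).trans u.2⟩, ?_, ?_⟩, ?_⟩, ?_⟩
  · intro u
    exact Subtype.ext (φ.symm_apply_apply (u : G.Vert))
  · intro u
    exact Subtype.ext (φ.apply_symm_apply (u : H.Vert))
  · intro u v
    exact φ.map_adj_iff (v := (u : G.Vert)) (w := (v : G.Vert))
  · exact Subtype.ext hφ

/-- Balls of radius `0` are single vertices, so they are always isomorphic. -/
lemma ballIso_zero (G H : RootedGraph) : BallIso 0 G H := by
  have key : ∀ (K : RootedGraph) (u : K.ballSet 0), u = ⟨K.root, K.root_mem_ballSet 0⟩ := by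
    intro K u
    have h0 : K.graph.dist K.root u = 0 := Nat.le_zero.mp u.2
    exact Subtype.ext ((K.connected.dist_eq_zero_iff).mp h0).symm
  refine ⟨⟨⟨fun _ => ⟨H.root, H.root_mem_ballSet 0⟩, fun _ => ⟨G.root, G.root_mem_ballSet 0⟩,
    fun u => (key G u).symm, fun u => (key H u).symm⟩, ?_⟩, rfl⟩
  intro u v
  rw [key G u, key G v]
  simp

/-- The local distance `2 ^ (- sup {r : B_r(G) ≅ B_r(H)})`, written as the infimum of `2 ^ (-r)`
over all `r` with `B_r(G) ≅ B_r(H)`; it is `0` if the supremum is infinite. -/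
noncomputable def locDist (G H : RootedGraph) : ℝ :=
  ⨅ r : {r : ℕ // BallIso r G H}, ((1 : ℝ) / 2) ^ (r : ℕ)

lemma bddBelow_locDist (G H : RootedGraph) :
    BddBelow (Set.range fun r : {r : ℕ // BallIso r G H} => ((1 : ℝ) / 2) ^ (r : ℕ)) :=
  ⟨0, by rintro _ ⟨r, rfl⟩; positivity⟩

instance (G H : RootedGraph) : Nonempty {r : ℕ // BallIso r G H} := ⟨⟨0, ballIso_zero G H⟩⟩

lemma locDist_nonneg (G H : RootedGraph) : 0 ≤ locDist G H :=
  le_ciInf fun r => by positivity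

lemma locDist_le {G H : RootedGraph} {r : ℕ} (h : BallIso r G H) :
    locDist G H ≤ ((1 : ℝ) / 2) ^ r :=
  ciInf_le (bddBelow_locDist G H) ⟨r, h⟩

lemma locDist_self (G : RootedGraph) : locDist G G = 0 := by
  refine le_antisymm (le_of_forall_pos_le_add fun ε hε => ?_) (locDist_nonneg G G)
  obtain ⟨n, hn⟩ := exists_pow_lt_of_lt_one hε (by norm_num : (1 : ℝ) / 2 < 1)
  rw [zero_add]
  exact (locDist_le (BallIso.refl n G)).trans hn.le

lemma locDist_comm_le (G H : RootedGraph) : locDist G H ≤ locDist H G :=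
  le_ciInf fun r => locDist_le r.2.symm

lemma locDist_triangle (G H K : RootedGraph) : locDist G K ≤ locDist G H + locDist H K := by
  refine le_of_forall_pos_le_add fun ε hε => ?_
  obtain ⟨r, hr⟩ := exists_lt_of_ciInf_lt (lt_add_of_pos_right (locDist G H) hε)
  obtain ⟨s, hs⟩ := exists_lt_of_ciInf_lt (lt_add_of_pos_right (locDist H K) hε)
  have h1 := locDist_nonneg G H
  have h2 := locDist_nonneg H K
  rcases le_total (r : ℕ) (s : ℕ) with hrs | hrs
  · have := locDist_le (r.2.trans (s.2.mono hrs))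
    linarith
  · have := locDist_le ((r.2.mono hrs).trans s.2)
    linarith

lemma locDist_congr_le {G G' H H' : RootedGraph} (hG : G.Iso G') (hH : H.Iso H') :
    locDist G H ≤ locDist G' H' :=
  le_ciInf fun r => locDist_le (((hG.ballIso r).trans r.2).trans (hH.ballIso r).symm)

lemma locDist_congr {G G' H H' : RootedGraph} (hG : G.Iso G') (hH : H.Iso H') :
    locDist G H = locDist G' H' :=
  le_antisymm (locDist_congr_le hG hH) (locDist_congr_le hG.symm hH.symm)

/-- The degree of the root. -/
noncomputable def rootDegree (G : RootedGraph) : ℕ := (G.graph.neighborSet G.root).ncard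

lemma rootDegree_congr {G H : RootedGraph} (h : G.Iso H) : G.rootDegree = H.rootDegree := by
  obtain ⟨φ, hφ⟩ := h
  have h1 : (G.graph.neighborSet G.root).ncard = (H.graph.neighborSet (φ G.root)).ncard :=
    Nat.card_congr (φ.mapNeighborSet G.root)
  rw [rootDegree, rootDegree, h1, hφ]

/-- `emb'(H', G, r(G))` for the rooted graph `H' = (H, w)`: the number of injective homomorphisms
(`SimpleGraph.Copy`) from `H` to `G` that map `w` to the root of `G`. -/
noncomputable def rootEmb {W : Type} (H : SimpleGraph W) (w : W) (G : RootedGraph) : ℕ :=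
  Nat.card {f : H.Copy G.graph // f w = G.root}

lemma rootEmb_congr {W : Type} (H : SimpleGraph W) (w : W) {G K : RootedGraph} (h : G.Iso K) :
    rootEmb H w G = rootEmb H w K := by
  obtain ⟨φ, hφ⟩ := h
  have hφ' : φ.symm K.root = G.root := by rw [← hφ]; exact φ.symm_apply_apply _
  refine Nat.card_congr ⟨fun f => ⟨φ.toCopy.comp f.1, ?_⟩,
    fun f => ⟨φ.symm.toCopy.comp f.1, ?_⟩, ?_, ?_⟩
  · change φ (f.1 w) = K.root
    rw [f.2, hφ]
  · change φ.symm (f.1 w) = G.root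
    rw [f.2, hφ']
  · intro f
    apply Subtype.ext
    apply DFunLike.ext
    intro x
    exact φ.symm_apply_apply (f.1 x)
  · intro f
    apply Subtype.ext
    apply DFunLike.ext
    intro x
    exact φ.apply_symm_apply (f.1 x)

instance isoSetoid : Setoid RootedGraph where
  r := Iso
  iseqv := ⟨Iso.refl, Iso.symm, Iso.trans⟩

end RootedGraph

/-! ### The space of isomorphism classes -/

/-- The space of rooted connected locally finite graphs up to root preserving isomorphism. -/
def GStar : Type 1 := Quotient RootedGraph.isoSetoid

namespace GStar

/-- The isomorphism class of a rooted graph. -/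
def mk (G : RootedGraph) : GStar := Quotient.mk _ G

/-- The local distance on isomorphism classes. Its topology, its Borel sets and its bounded
continuous functions do not depend on the fact that classes at distance `0` coincide, so only the
laws of a pseudometric are recorded. -/
noncomputable instance : PseudoMetricSpace GStar where
  dist := Quotient.lift₂ RootedGraph.locDist fun _ _ _ _ h₁ h₂ => RootedGraph.locDist_congr h₁ h₂
  dist_self := by
    rintro ⟨G⟩
    exact RootedGraph.locDist_self G
  dist_comm := by
    rintro ⟨G⟩ ⟨H⟩
    exact le_antisymm (RootedGraph.locDist_comm_le G H) (RootedGraph.locDist_comm_le H G)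
  dist_triangle := by
    rintro ⟨G⟩ ⟨H⟩ ⟨K⟩
    exact RootedGraph.locDist_triangle G H K

noncomputable instance : MeasurableSpace GStar := borel GStar

instance : BorelSpace GStar := ⟨rfl⟩

/-- The degree of the root. -/
noncomputable def degree : GStar → ℕ :=
  Quotient.lift RootedGraph.rootDegree fun _ _ h => RootedGraph.rootDegree_congr h

/-- `emb'(H', ·)` for the rooted graph `H' = (H, w)`. -/
noncomputable def emb {W : Type} (H : SimpleGraph W) (w : W) : GStar → ℕ :=
  Quotient.lift (RootedGraph.rootEmb H w) fun _ _ h => RootedGraph.rootEmb_congr H w h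

end GStar

/-! ### Finite graphs and their local weak limits -/

section Finite

variable {V : Type} [Fintype V]

/-- The component of `v` in the finite graph `G`, rooted at `v`. -/
def rootedComponent (G : SimpleGraph V) (v : V) : RootedGraph where
  Vert := G.connectedComponentMk v
  graph := (G.connectedComponentMk v).toSimpleGraph
  root := ⟨v, rfl⟩
  connected := (G.connectedComponentMk v).connected_toSimpleGraph
  locallyFinite := fun _ => Set.toFinite _

/-- `𝔼 f(v*)` for a uniformly random `v*` in the finite set `V`. -/
noncomputable def vertexMean (f : V → ℝ) : ℝ := (∑ v, f v) / Fintype.card V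

/-- The degree of a vertex. -/
noncomputable def deg (G : SimpleGraph V) (v : V) : ℕ := (G.neighborSet v).ncard

/-- `emb(H, G)`: the number of injective homomorphisms from `H` to `G`. -/
noncomputable def embCount {W : Type} (H : SimpleGraph W) (G : SimpleGraph V) : ℕ :=
  Nat.card (H.Copy G)

/-- The complete graph on the vertex subset `S` (all other vertices of `V` are isolated). -/
def cliqueOn (S : Finset V) : SimpleGraph V where
  Adj u v := u ≠ v ∧ u ∈ S ∧ v ∈ S
  symm := ⟨fun _ _ h => ⟨h.1.symm, h.2.2, h.2.1⟩⟩
  loopless := ⟨fun _ h => h.1 rfl⟩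

/-- `G'` arises from `G` by removing edges that have at least one endpoint in `S` and adding edges
between vertices of `S`. -/
def EditedAt (S : Finset V) (G G' : SimpleGraph V) : Prop :=
  (∀ u v, G.Adj u v → ¬ G'.Adj u v → u ∈ S ∨ v ∈ S) ∧
  (∀ u v, G'.Adj u v → ¬ G.Adj u v → u ∈ S ∧ v ∈ S)

end Finite

section Sequences

variable {V : ℕ → Type} [∀ n, Fintype (V n)]

/-- `G n → G*`, where `G*` has law `μ`: weak convergence of the laws of the component of a
uniformly random vertex, that is `𝔼 f(G n, v*) → 𝔼 f(G*)` for all bounded continuous `f`. -/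
def LocalWeakLimit (G : ∀ n, SimpleGraph (V n)) (μ : Measure GStar) : Prop :=
  ∀ f : GStar →ᵇ ℝ,
    Tendsto (fun n => vertexMean fun v => f (GStar.mk (rootedComponent (G n) v))) atTop
      (𝓝 (∫ x, f x ∂μ))

/-- `𝔼 (d_n)^k → 𝔼 (d*)^k`. -/
def DegreeMomentsConverge (G : ∀ n, SimpleGraph (V n)) (μ : Measure GStar) (k : ℕ) : Prop :=
  Tendsto (fun n => ENNReal.ofReal (vertexMean fun v => (deg (G n) v : ℝ) ^ k)) atTop
    (𝓝 (∫⁻ x, (x.degree : ℝ≥0∞) ^ k ∂μ))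

open Classical in
/-- `(d_n)^k` is uniformly integrable: `sup_n 𝔼 (d_n)^k 𝟙[(d_n)^k > a] → 0` as `a → ∞`. -/
def DegreePowUniformlyIntegrable (G : ∀ n, SimpleGraph (V n)) (k : ℕ) : Prop :=
  ∀ ε : ℝ, 0 < ε → ∃ a : ℝ, ∀ n,
    vertexMean (fun v => if a < (deg (G n) v : ℝ) ^ k then (deg (G n) v : ℝ) ^ k else 0) ≤ ε

/-- `|V(G n)|⁻¹ emb(H, G n) → 𝔼 emb'(H', G*, r*)` for each connected `H` on `h` vertices and each
of the `h` rooted graphs `H' = (H, w)`. -/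
def EmbeddingCountsConverge (G : ∀ n, SimpleGraph (V n)) (μ : Measure GStar) (h : ℕ) : Prop :=
  ∀ H : SimpleGraph (Fin h), H.Connected → ∀ w : Fin h,
    Tendsto (fun n => ENNReal.ofReal ((embCount H (G n) : ℝ) / Fintype.card (V n))) atTop
      (𝓝 (∫⁻ x, (GStar.emb H w x : ℝ≥0∞) ∂μ))

end Sequences

end LocalLimit

open LocalLimit

namespace LocalLimit

/-! ### Continuity of functions that depend on a ball only -/

/-! Local weak limits see only balls of bounded radius, and an edit at `S` leaves the `r`-ball of
`v` alone unless that ball meets `S` (`ballIso_of_editedAt`). It remains to see that few vertices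
lie near `S`. If `v` is within `r` of `s ∈ S`, then `B_r(s) ⊆ B_{2r}(v)`. So either `B_{2r}(v)` has
more than `M` vertices, or `s` has at most `M` vertices within `r` and accounts for at most `M` such
`v` (`card_near_le`). The first case has small probability for large `M`, since ball sizes are
continuous on `GStar` and finite in the limit; the second has proportion at most `M|S|/|V| → 0`.
Bounded Lipschitz test functions then give (a), and (a) gives the limit in (b).

The failures in (b) are an escape of mass. For a degree statistic `F`, the truncated means of `min
(F d) M` converge to limits that approach `𝔼 F(d*)` as `M` grows, while the `o(n)` vertices of the
clique, of degree at least `|S| - 1`, contribute at least `δ > 0` on top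
(`not_tendsto_of_large_degrees`). Powers refute (i); falling factorials, which count stars, refute
(iii); the same `δ` sits above every threshold and refutes (ii). -/

lemma GStar.continuous_of_ballIso {β : Type*} [TopologicalSpace β] {f : GStar → β} (r : ℕ)
    (hf : ∀ G H : RootedGraph, RootedGraph.BallIso r G H → f (GStar.mk G) = f (GStar.mk H)) :
    Continuous f := by
  rw [continuous_iff_continuousAt]
  intro x
  -- `f` is locally constant: a distance below `2^(-r)` forces an isomorphism of balls of some
  -- radius `s > r`.
  refine tendsto_const_nhds.congr' ?_
  filter_upwards [Metric.ball_mem_nhds x (show (0 : ℝ) < (1 / 2) ^ r by positivity)] with y hy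
  induction x using Quotient.inductionOn with | _ G => ?_
  induction y using Quotient.inductionOn with | _ H => ?_
  have hd : RootedGraph.locDist H G < (1 / 2) ^ r := hy
  obtain ⟨s, hs⟩ := exists_lt_of_ciInf_lt hd
  have hrs : r < s := (pow_lt_pow_iff_right_of_lt_one₀ (by norm_num) (by norm_num)).mp hs
  exact hf G H (s.2.mono hrs.le).symm

/-- The number of vertices at distance at most `r` from the root. -/
noncomputable def GStar.ballCard (r : ℕ) : GStar → ℕ :=
  Quotient.lift (fun G => (G.ballSet r).ncard) fun _ _ h => by
    obtain ⟨φ, -⟩ := RootedGraph.Iso.ballIso h r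
    exact Nat.card_congr φ.toEquiv

lemma GStar.continuous_ballCard (r : ℕ) : Continuous (GStar.ballCard r) :=
  GStar.continuous_of_ballIso r fun _ _ ⟨φ, _⟩ => Nat.card_congr φ.toEquiv

lemma RootedGraph.ballSet_one (G : RootedGraph) :
    G.ballSet 1 = insert G.root (G.graph.neighborSet G.root) := by
  ext u
  change G.graph.dist G.root u ≤ 1 ↔ u = G.root ∨ G.graph.Adj G.root u
  rw [Nat.le_one_iff_eq_zero_or_eq_one, SimpleGraph.dist_eq_one_iff_adj,
    G.connected.dist_eq_zero_iff, eq_comm]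

lemma GStar.degree_eq (x : GStar) : x.degree = x.ballCard 1 - 1 := by
  induction x using Quotient.inductionOn with | _ G => ?_
  change G.rootDegree = (G.ballSet 1).ncard - 1
  rw [G.ballSet_one, Set.ncard_insert_of_notMem (by simp) (G.locallyFinite _)]
  rfl

lemma GStar.continuous_degree : Continuous GStar.degree := by
  rw [funext GStar.degree_eq]
  exact (continuous_of_discreteTopology (f := fun m : ℕ => m - 1)).comp (GStar.continuous_ballCard 1)

/-! ### Balls in finite graphs -/

/-- The vertices that can be reached from `v` by a walk of length at most `r`. -/
def walkBall {V : Type} (G : SimpleGraph V) (r : ℕ) (v : V) : Set V :=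
  {u | ∃ p : G.Walk v u, p.length ≤ r}

section Balls

variable {V : Type} {G : SimpleGraph V}

lemma walkBall_symm {r : ℕ} {u v : V} (h : u ∈ walkBall G r v) : v ∈ walkBall G r u := by
  obtain ⟨p, hp⟩ := h
  exact ⟨p.reverse, by simpa using hp⟩

lemma walkBall_trans {r s : ℕ} {u v w : V} (h : u ∈ walkBall G r v) (h' : w ∈ walkBall G s u) :
    w ∈ walkBall G (r + s) v := by
  obtain ⟨p, hp⟩ := h
  obtain ⟨q, hq⟩ := h'
  exact ⟨p.append q, by simpa using add_le_add hp hq⟩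

lemma walkBall_succ_of_adj {r : ℕ} {u v w : V} (h : u ∈ walkBall G r v) (h' : G.Adj u w) :
    w ∈ walkBall G (r + 1) v :=
  walkBall_trans h ⟨h'.toWalk, by simp⟩

lemma exists_adj_of_mem_walkBall_succ {r : ℕ} {u v : V} (h : u ∈ walkBall G (r + 1) v) :
    u = v ∨ ∃ w ∈ walkBall G r v, G.Adj w u := by
  obtain ⟨p, hp⟩ := walkBall_symm h
  cases p with
  | nil => exact .inl rfl
  | @cons _ w _ hadj q =>
    exact .inr ⟨w, walkBall_symm ⟨q, by simpa using hp⟩, hadj.symm⟩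

lemma walkBall_mono {r s : ℕ} (hrs : r ≤ s) (v : V) : walkBall G r v ⊆ walkBall G s v :=
  fun _ ⟨p, hp⟩ => ⟨p, hp.trans hrs⟩

lemma mem_walkBall_self (r : ℕ) (v : V) : v ∈ walkBall G r v := ⟨.nil, by simp⟩

/-- A walk from `v` never leaves the component of `v`, so distances there can be measured by walks
in the whole graph. This avoids comparing different component types when `G` is edited. -/
lemma dist_toSimpleGraph_le_iff {v : V} {r : ℕ} (u : G.connectedComponentMk v) :
    (G.connectedComponentMk v).toSimpleGraph.dist ⟨v, rfl⟩ u ≤ r ↔ u.1 ∈ walkBall G r v := by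
  constructor
  · intro h
    obtain ⟨p, hp⟩ := (G.connectedComponentMk v).connected_toSimpleGraph.exists_walk_length_eq_dist
      ⟨v, rfl⟩ u
    refine ⟨p.map (G.connectedComponentMk v).toSimpleGraph_hom, ?_⟩
    exact (SimpleGraph.Walk.length_map _ p).trans_le (hp.trans_le h)
  · classical
    rintro ⟨p, hp⟩
    have hs : ∀ x ∈ p.support, x ∈ (G.connectedComponentMk v).supp := fun x hx =>
      SimpleGraph.ConnectedComponent.sound (p.takeUntil x hx).reachable.symm
    have hl : (p.induce _ hs).length = p.length :=
      (SimpleGraph.Walk.length_map _ _).symm.trans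
        (congrArg SimpleGraph.Walk.length (p.map_induce hs))
    exact (SimpleGraph.dist_le (p.induce _ hs)).trans (hl.trans_le hp)

lemma mem_component_of_mem_walkBall {r : ℕ} {u v : V} (h : u ∈ walkBall G r v) :
    u ∈ (G.connectedComponentMk v).supp := by
  obtain ⟨p, -⟩ := h
  exact SimpleGraph.ConnectedComponent.sound p.reachable.symm

lemma walkBall_one (G : SimpleGraph V) (v : V) :
    walkBall G 1 v = insert v (G.neighborSet v) := by
  ext u
  constructor
  · intro h
    rcases exists_adj_of_mem_walkBall_succ (r := 0) h with h | ⟨w, ⟨p, hp⟩, hw⟩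
    · exact .inl h
    · obtain rfl := SimpleGraph.Walk.eq_of_length_eq_zero (Nat.le_zero.mp hp)
      exact .inr hw
  · rintro (rfl | h)
    · exact mem_walkBall_self 1 _
    · exact walkBall_succ_of_adj (mem_walkBall_self 0 v) h

/-- Induction on the radius: the last step leaves a vertex `w` of the smaller ball, so `w ∉ S`. An
added edge would need `w ∈ S`; a removed one would put `w` or its other end, both in the larger ball
of `G`, into `S`. -/
lemma walkBall_eq_of_editedAt {S : Finset V} {G G' : SimpleGraph V} (hE : EditedAt S G G')
    {v : V} : ∀ {r : ℕ}, (∀ s ∈ S, s ∉ walkBall G r v) → walkBall G' r v = walkBall G r v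
  | 0, _ => by
    ext u
    constructor <;> rintro ⟨p, hp⟩ <;>
      obtain rfl := SimpleGraph.Walk.eq_of_length_eq_zero (Nat.le_zero.mp hp) <;>
      exact mem_walkBall_self 0 _
  | r + 1, h => by
    have hr : ∀ s ∈ S, s ∉ walkBall G r v := fun s hs hv =>
      h s hs (walkBall_mono r.le_succ v hv)
    have ih := walkBall_eq_of_editedAt hE hr
    ext u
    constructor
    · intro hu
      rcases exists_adj_of_mem_walkBall_succ hu with rfl | ⟨w, hw, hadj⟩
      · exact mem_walkBall_self _ _
      · rw [ih] at hw
        refine walkBall_succ_of_adj hw ?_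
        by_contra hn
        exact hr w (hE.2 w u hadj hn).1 hw
    · intro hu
      rcases exists_adj_of_mem_walkBall_succ hu with rfl | ⟨w, hw, hadj⟩
      · exact mem_walkBall_self _ _
      · refine walkBall_succ_of_adj (ih ▸ hw) ?_
        by_contra hn
        rcases hE.1 w u hadj hn with hs | hs
        · exact hr w hs hw
        · exact h u hs hu

variable [Fintype V]

/-- The ball around the root of a component, as a set of vertices of the whole graph. -/
def rootedComponentBallEquiv (G : SimpleGraph V) (r : ℕ) (v : V) :
    (rootedComponent G v).ballSet r ≃ walkBall G r v where
  toFun u := ⟨u.1.1, (dist_toSimpleGraph_le_iff _).mp u.2⟩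
  invFun u := ⟨⟨u.1, mem_component_of_mem_walkBall u.2⟩, (dist_toSimpleGraph_le_iff _).mpr u.2⟩
  left_inv _ := rfl
  right_inv _ := rfl

lemma ballCard_rootedComponent (G : SimpleGraph V) (r : ℕ) (v : V) :
    (GStar.mk (rootedComponent G v)).ballCard r = (walkBall G r v).ncard :=
  Nat.card_congr (rootedComponentBallEquiv G r v)

lemma degree_rootedComponent (G : SimpleGraph V) (v : V) :
    (GStar.mk (rootedComponent G v)).degree = deg G v := by
  rw [GStar.degree_eq, ballCard_rootedComponent, walkBall_one,
    Set.ncard_insert_of_notMem (by simp), Nat.add_sub_cancel, deg]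

lemma ballIso_of_editedAt {S : Finset V} {G G' : SimpleGraph V} (hE : EditedAt S G G')
    {v : V} {r : ℕ} (h : ∀ s ∈ S, s ∉ walkBall G r v) :
    RootedGraph.BallIso r (rootedComponent G v) (rootedComponent G' v) := by
  refine ⟨⟨(rootedComponentBallEquiv G r v).trans <| (Equiv.setCongr
    (walkBall_eq_of_editedAt hE h).symm).trans (rootedComponentBallEquiv G' r v).symm, ?_⟩, rfl⟩
  intro a b
  have ha : a.1.1 ∉ S := fun hs => h _ hs (rootedComponentBallEquiv G r v a).2
  change G'.Adj a.1.1 b.1.1 ↔ G.Adj a.1.1 b.1.1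
  constructor
  · intro hadj
    by_contra hn
    exact ha (hE.2 _ _ hadj hn).1
  · intro hadj
    by_contra hn
    rcases hE.1 _ _ hadj hn with hs | hs
    · exact ha hs
    · exact h _ hs (rootedComponentBallEquiv G r v b).2

open Classical in
/-- Few vertices are close to `S`, except for those with a large neighbourhood. -/
lemma card_near_le (G : SimpleGraph V) (S : Finset V) (r M : ℕ) :
    (Finset.univ.filter fun v => ∃ s ∈ S, s ∈ walkBall G r v).card ≤
      M * S.card + (Finset.univ.filter fun v => M < (walkBall G (r + r) v).ncard).card := by
  have hsub : (Finset.univ.filter fun v => ∃ s ∈ S, s ∈ walkBall G r v) ⊆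
      ((S.filter fun s => (walkBall G r s).ncard ≤ M).biUnion fun s => (walkBall G r s).toFinset) ∪
        Finset.univ.filter fun v => M < (walkBall G (r + r) v).ncard := by
    intro v hv
    obtain ⟨s, hs, hsv⟩ := (Finset.mem_filter.mp hv).2
    by_cases hM : M < (walkBall G (r + r) v).ncard
    · exact Finset.mem_union_right _ (by simpa using hM)
    -- Here `B_r(s) ⊆ B_{2r}(v)`, so a small ball at `v` bounds the ball at `s`, and `v` is one of
    -- its at most `M` vertices.
    · have : (walkBall G r s).ncard ≤ M :=
        (Set.ncard_le_ncard (fun _ hu => walkBall_trans hsv hu)).trans (not_lt.mp hM)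
      refine Finset.mem_union_left _ (Finset.mem_biUnion.mpr ⟨s, by simp [hs, this], ?_⟩)
      simpa using walkBall_symm hsv
  refine (Finset.card_le_card hsub).trans ((Finset.card_union_le _ _).trans ?_)
  gcongr
  refine (Finset.card_biUnion_le_card_mul _ _ M fun s hs => ?_).trans ?_
  · rw [← Set.ncard_eq_toFinset_card']
    exact (Finset.mem_filter.mp hs).2
  · rw [mul_comm]
    gcongr
    exact Finset.filter_subset _ _

end Balls

/-! ### Stars -/

/-- Copies of a star with prescribed centre are injections from its leaves to the neighbours of
the centre. -/
noncomputable def starCopyEquiv {V : Type} (G : SimpleGraph V) (k : ℕ) (v : V) :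
    {f : (SimpleGraph.starGraph (0 : Fin (k + 1))).Copy G // f 0 = v} ≃
      (Fin k ↪ G.neighborSet v) where
  toFun f := ⟨fun i => ⟨f.1 i.succ, by
      have h := f.1.toHom.map_adj (SimpleGraph.starGraph_center_adj (Fin.succ_ne_zero i).symm)
      have h' : G.Adj (f.1 0) (f.1 i.succ) := h
      rwa [f.2] at h'⟩,
    fun i j hij => Fin.succ_injective _ (f.1.injective' (congrArg Subtype.val hij))⟩
  invFun g := ⟨⟨⟨Fin.cons v fun i => (g i : V), by
      intro a b hab
      rw [SimpleGraph.starGraph_adj] at hab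
      induction a using Fin.cases with
      | zero =>
        induction b using Fin.cases with
        | zero => simp at hab
        | succ j => exact (g j).2
      | succ i =>
        induction b using Fin.cases with
        | zero => exact (g i).2.symm
        | succ j => simp at hab⟩, by
      have hv : v ∉ Set.range fun i => (g i : V) := by
        rintro ⟨i, hi⟩
        exact G.ne_of_adj (g i).2 hi.symm
      exact Fin.cons_injective_iff.mpr ⟨hv, Subtype.val_injective.comp g.injective⟩⟩, rfl⟩
  left_inv f := by
    apply Subtype.ext
    apply DFunLike.ext
    intro x
    induction x using Fin.cases with
    | zero => exact f.2.symm
    | succ i => rfl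
  right_inv g := rfl

lemma card_starCopy {V : Type} (G : SimpleGraph V) (k : ℕ) (v : V) (hv : (G.neighborSet v).Finite) :
    Nat.card {f : (SimpleGraph.starGraph (0 : Fin (k + 1))).Copy G // f 0 = v} =
      (G.neighborSet v).ncard.descFactorial k := by
  classical
  have := hv.fintype
  rw [Nat.card_congr (starCopyEquiv G k v), Nat.card_eq_fintype_card, Fintype.card_embedding_eq,
    Fintype.card_fin, ← Nat.card_eq_fintype_card]
  rfl

lemma emb_star (k : ℕ) (x : GStar) :
    GStar.emb (SimpleGraph.starGraph (0 : Fin (k + 1))) 0 x = x.degree.descFactorial k := by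
  induction x using Quotient.inductionOn with | _ G => ?_
  exact card_starCopy G.graph k G.root (G.locallyFinite _)

/-- Sorting copies by the image of the centre turns the count into a degree statistic, so (iii) for
centre-rooted stars has the form of (i) with falling factorials. -/
lemma embCount_star {V : Type} [Fintype V] (G : SimpleGraph V) (k : ℕ) :
    embCount (SimpleGraph.starGraph (0 : Fin (k + 1))) G = ∑ v, (deg G v).descFactorial k := by
  have : Finite ((SimpleGraph.starGraph (0 : Fin (k + 1))).Copy G) :=
    Finite.of_injective _ DFunLike.coe_injective
  rw [embCount, ← Nat.card_congr (Equiv.sigmaFiberEquiv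
    fun f : (SimpleGraph.starGraph (0 : Fin (k + 1))).Copy G => f 0), Nat.card_sigma]
  exact Finset.sum_congr rfl fun v _ => card_starCopy G k v (Set.toFinite _)

/-! ### Averages over the vertices -/

section Mean

variable {V : Type} [Fintype V]

lemma vertexMean_mono {f g : V → ℝ} (h : ∀ v, f v ≤ g v) : vertexMean f ≤ vertexMean g :=
  div_le_div_of_nonneg_right (Finset.sum_le_sum fun v _ => h v) (Nat.cast_nonneg _)

lemma vertexMean_nonneg {f : V → ℝ} (h : ∀ v, 0 ≤ f v) : 0 ≤ vertexMean f :=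
  div_nonneg (Finset.sum_nonneg fun v _ => h v) (Nat.cast_nonneg _)

lemma vertexMean_add (f g : V → ℝ) :
    vertexMean (fun v => f v + g v) = vertexMean f + vertexMean g := by
  simp only [vertexMean, Finset.sum_add_distrib, add_div]

lemma vertexMean_sub (f g : V → ℝ) :
    vertexMean (fun v => f v - g v) = vertexMean f - vertexMean g := by
  simp only [vertexMean, Finset.sum_sub_distrib, sub_div]

lemma abs_vertexMean_le (f : V → ℝ) : |vertexMean f| ≤ vertexMean fun v => |f v| := by
  rw [vertexMean, abs_div, Nat.abs_cast]
  exact div_le_div_of_nonneg_right (Finset.abs_sum_le_sum_abs _ _) (Nat.cast_nonneg _)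

lemma vertexMean_const [Nonempty V] (c : ℝ) : vertexMean (fun _ : V => c) = c := by
  rw [vertexMean, Finset.sum_const, nsmul_eq_mul, Finset.card_univ]
  field_simp

lemma vertexMean_ite (p : V → Prop) [DecidablePred p] (c : ℝ) :
    vertexMean (fun v => if p v then c else 0) =
      (Finset.univ.filter p).card * c / Fintype.card V := by
  rw [vertexMean, ← Finset.sum_filter, Finset.sum_const, nsmul_eq_mul]

lemma vertexMean_ite_mem [DecidableEq V] (S : Finset V) (c : ℝ) :
    vertexMean (fun v => if v ∈ S then c else 0) = S.card * c / Fintype.card V := by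
  rw [vertexMean_ite]
  simp

/-- The law of the component of a uniformly random vertex. -/
noncomputable def componentLaw (G : SimpleGraph V) : Measure GStar :=
  (Fintype.card V : ℝ≥0∞)⁻¹ • ∑ v, Measure.dirac (GStar.mk (rootedComponent G v))

instance [Nonempty V] (G : SimpleGraph V) : IsProbabilityMeasure (componentLaw G) := by
  constructor
  rw [componentLaw, Measure.smul_apply, Measure.finsetSum_apply]
  simp only [measure_univ, Finset.sum_const, Finset.card_univ, nsmul_eq_mul, mul_one, smul_eq_mul]
  exact ENNReal.inv_mul_cancel (by simp) (ENNReal.natCast_ne_top _)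

lemma integral_componentLaw (G : SimpleGraph V) {f : GStar → ℝ} (hf : Continuous f) :
    ∫ x, f x ∂componentLaw G = vertexMean fun v => f (GStar.mk (rootedComponent G v)) := by
  have hm : StronglyMeasurable f := hf.stronglyMeasurable
  have hint : ∀ v ∈ Finset.univ,
      Integrable f (Measure.dirac (GStar.mk (rootedComponent G v))) := fun v _ =>
    integrable_dirac' hm (by simp)
  rw [componentLaw, integral_smul_measure, integral_finsetSum_measure hint]
  simp only [integral_dirac' f _ hm, vertexMean, ENNReal.toReal_inv, ENNReal.toReal_natCast,
    smul_eq_mul]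
  rw [div_eq_inv_mul]

end Mean

/-! ### Consequences of local weak convergence -/

section Limits

variable {V : ℕ → Type} [∀ n, Fintype (V n)] {G : ∀ n, SimpleGraph (V n)} {μ : Measure GStar}

/-- As `ℕ` is discrete, even indicators and truncations of a continuous integer statistic are
continuous test functions. -/
lemma LocalWeakLimit.tendsto_comp_nat (hG : LocalWeakLimit G μ) {N : GStar → ℕ}
    (hN : Continuous N) {g : ℕ → ℝ} {C : ℝ} (hg : ∀ m, |g m| ≤ C) :
    Tendsto (fun n => vertexMean fun v => g (N (GStar.mk (rootedComponent (G n) v)))) atTop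
      (𝓝 (∫ x, g (N x) ∂μ)) :=
  hG (BoundedContinuousFunction.ofNormedAddCommGroup (fun x => g (N x))
    (continuous_of_discreteTopology.comp hN) C fun _ => hg _)

open Classical in
/-- Only few vertices are close to a small set of vertices. -/
lemma LocalWeakLimit.tendsto_near [IsProbabilityMeasure μ] (hG : LocalWeakLimit G μ)
    {S : ∀ n, Finset (V n)}
    (hS : (fun n => ((S n).card : ℝ)) =o[atTop] fun n => (Fintype.card (V n) : ℝ)) (r : ℕ) :
    Tendsto (fun n => ((Finset.univ.filter fun v => ∃ s ∈ S n, s ∈ walkBall (G n) r v).card : ℝ) /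
      Fintype.card (V n)) atTop (𝓝 0) := by
  let g : ℕ → ℕ → ℝ := fun M m => if M < m then 1 else 0
  have hg : ∀ M m, |g M m| ≤ 1 := by
    intro M m
    dsimp only [g]
    split_ifs <;> simp
  have hN := GStar.continuous_ballCard (r + r)
  have htail : Tendsto (fun M => ∫ x, g M (GStar.ballCard (r + r) x) ∂μ) atTop (𝓝 0) := by
    have h0 : (0 : ℝ) = ∫ _x : GStar, (0 : ℝ) ∂μ := by simp
    rw [h0]
    refine tendsto_integral_of_dominated_convergence (fun _ => 1) (fun M => ?_)
      (integrable_const 1) (fun M => .of_forall fun x => hg M _) (.of_forall fun x => ?_)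
    · exact ((continuous_of_discreteTopology (f := g M)).comp hN).aestronglyMeasurable
    · refine tendsto_const_nhds.congr' ?_
      filter_upwards [eventually_ge_atTop (GStar.ballCard (r + r) x)] with M hM
      simp [g, not_lt.mpr hM]
  refine tendsto_order.mpr ⟨fun a ha => .of_forall fun n => ha.trans_le (by positivity),
    fun ε hε => ?_⟩
  obtain ⟨M, hM⟩ := (htail.eventually (gt_mem_nhds hε)).exists
  have hlim := (hS.tendsto_div_nhds_zero.const_mul (M : ℝ)).add
    (hG.tendsto_comp_nat hN (hg M))
  rw [mul_zero, zero_add] at hlim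
  filter_upwards [hlim.eventually (gt_mem_nhds hM)] with n hn
  refine lt_of_le_of_lt ?_ hn
  simp only [ballCard_rootedComponent, g]
  rw [vertexMean_ite, mul_one, mul_div_assoc', ← add_div]
  refine div_le_div_of_nonneg_right ?_ (Nat.cast_nonneg _)
  exact_mod_cast card_near_le (G n) (S n) r M

/-- Bounded Lipschitz test functions suffice for local weak convergence. -/
lemma localWeakLimit_of_lipschitz [∀ n, Nonempty (V n)] [IsProbabilityMeasure μ]
    (h : ∀ f : GStar → ℝ, (∃ C : ℝ, ∀ x y, dist (f x) (f y) ≤ C) → (∃ L, LipschitzWith L f) →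
      Tendsto (fun n => vertexMean fun v => f (GStar.mk (rootedComponent (G n) v))) atTop
        (𝓝 (∫ x, f x ∂μ))) : LocalWeakLimit G μ := by
  let μs : ℕ → ProbabilityMeasure GStar := fun n => ⟨componentLaw (G n), inferInstance⟩
  have key : Tendsto μs atTop (𝓝 ⟨μ, inferInstance⟩) := by
    refine tendsto_iff_forall_lipschitz_integral_tendsto.mpr fun f hb hL => ?_
    refine (h f hb hL).congr fun n => ?_
    exact (integral_componentLaw (G n) hL.choose_spec.continuous).symm
  intro f
  refine (ProbabilityMeasure.tendsto_iff_forall_integral_tendsto.mp key f).congr fun n => ?_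
  exact integral_componentLaw (G n) f.continuous

lemma GStar.dist_mk_le {A B : RootedGraph} {r : ℕ} (h : RootedGraph.BallIso r A B) :
    dist (GStar.mk A) (GStar.mk B) ≤ (1 / 2) ^ r :=
  RootedGraph.locDist_le h

/-- Editing the edges at a small set of vertices does not change the local weak limit. -/
theorem LocalWeakLimit.of_editedAt [∀ n, Nonempty (V n)] [IsProbabilityMeasure μ]
    (hG : LocalWeakLimit G μ) {S : ∀ n, Finset (V n)}
    (hS : (fun n => ((S n).card : ℝ)) =o[atTop] fun n => (Fintype.card (V n) : ℝ))
    {G' : ∀ n, SimpleGraph (V n)} (hE : ∀ n, EditedAt (S n) (G n) (G' n)) :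
    LocalWeakLimit G' μ := by
  classical
  refine localWeakLimit_of_lipschitz fun f ⟨C, hC⟩ ⟨L, hL⟩ => ?_
  have hG0 := hG (BoundedContinuousFunction.mkOfBound ⟨f, hL.continuous⟩ C hC)
  have hG1 : Tendsto (fun n => vertexMean fun v => f (GStar.mk (rootedComponent (G n) v))) atTop
      (𝓝 (∫ x, f x ∂μ)) := hG0
  have hC0 : 0 ≤ C := dist_nonneg.trans
    (hC (GStar.mk (rootedComponent (G 0) (Classical.arbitrary _)))
      (GStar.mk (rootedComponent (G 0) (Classical.arbitrary _))))
  refine tendsto_of_tendsto_of_dist hG1 ?_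
  refine tendsto_order.mpr ⟨fun a ha => .of_forall fun n => ha.trans_le dist_nonneg,
    fun ε hε => ?_⟩
  have hpow : Tendsto (fun r : ℕ => (L : ℝ) * (1 / 2) ^ r) atTop (𝓝 0) := by
    simpa using (tendsto_pow_atTop_nhds_zero_of_lt_one (by norm_num : (0 : ℝ) ≤ 1 / 2)
      (by norm_num)).const_mul (L : ℝ)
  obtain ⟨r, hr⟩ := (hpow.eventually (gt_mem_nhds hε)).exists
  have hlim := ((hG.tendsto_near hS r).mul_const C).const_add ((L : ℝ) * (1 / 2) ^ r)
  rw [zero_mul, add_zero] at hlim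
  filter_upwards [hlim.eventually (gt_mem_nhds hr)] with n hn
  refine lt_of_le_of_lt ?_ hn
  rw [Real.dist_eq, ← vertexMean_sub]
  refine (abs_vertexMean_le _).trans ?_
  -- The bound is itself a vertex mean, so it can be checked pointwise: near `S` the oscillation `C`
  -- of `f` is paid, elsewhere only `L * 2^(-r)`.
  rw [div_mul_eq_mul_div, ← vertexMean_ite, ← vertexMean_const (V := V n) ((L : ℝ) * (1 / 2) ^ r),
    ← vertexMean_add]
  refine vertexMean_mono fun v => ?_
  rw [← Real.dist_eq]
  split_ifs with hv
  · exact (hC _ _).trans (le_add_of_nonneg_left (by positivity))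
  · rw [add_zero]
    push Not at hv
    refine (hL.dist_le_mul _ _).trans ?_
    gcongr
    exact GStar.dist_mk_le (ballIso_of_editedAt (hE n) hv)

/-- If the vertices of large degree carry a non-vanishing part of the mean of `F (deg v)`, then
these means do not converge to the one of the limit. -/
theorem not_tendsto_of_large_degrees [IsProbabilityMeasure μ]
    (hG : LocalWeakLimit G μ) {S : ∀ n, Finset (V n)}
    (hS : (fun n => ((S n).card : ℝ)) =o[atTop] fun n => (Fintype.card (V n) : ℝ))
    {F : ℕ → ℕ} (hF : Monotone F) (hfin : ∫⁻ x : GStar, (F x.degree : ℝ≥0∞) ∂μ < ⊤)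
    {D : ℕ → ℕ} (hD : ∀ n, ∀ v ∈ S n, D n ≤ deg (G n) v) {δ : ℝ} (hδ : 0 < δ)
    (hlarge : ∀ᶠ n in atTop, δ ≤ (S n).card * F (D n) / (Fintype.card (V n) : ℝ)) :
    ¬ Tendsto (fun n => ENNReal.ofReal (vertexMean fun v => (F (deg (G n) v) : ℝ))) atTop
      (𝓝 (∫⁻ x, (F x.degree : ℝ≥0∞) ∂μ)) := by
  classical
  intro hconv
  have hcont : ∀ g : ℕ → ℝ, Continuous fun x : GStar => g x.degree := fun g =>
    continuous_of_discreteTopology.comp GStar.continuous_degree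
  have hmeas : ∀ g : ℕ → ℝ, AEStronglyMeasurable (fun x : GStar => g x.degree) μ := fun g =>
    (hcont g).aestronglyMeasurable
  have hofReal : ∀ x : GStar, ENNReal.ofReal (F x.degree : ℝ) = (F x.degree : ℝ≥0∞) := fun x =>
    ENNReal.ofReal_natCast _
  have hint : Integrable (fun x : GStar => (F x.degree : ℝ)) μ := by
    refine ⟨hmeas fun m => F m, ?_⟩
    rw [hasFiniteIntegral_iff_ofReal (.of_forall fun _ => Nat.cast_nonneg _)]
    simpa only [hofReal] using hfin
  have hL : (∫⁻ x : GStar, (F x.degree : ℝ≥0∞) ∂μ).toReal = ∫ x : GStar, (F x.degree : ℝ) ∂μ := by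
    rw [integral_eq_lintegral_of_nonneg_ae (.of_forall fun _ => Nat.cast_nonneg _)
      (hmeas fun m => F m)]
    simp only [hofReal]
  have hreal : Tendsto (fun n => vertexMean fun v => (F (deg (G n) v) : ℝ)) atTop
      (𝓝 (∫ x : GStar, (F x.degree : ℝ) ∂μ)) := by
    rw [← hL]
    refine ((ENNReal.tendsto_toReal hfin.ne).comp hconv).congr fun n => ?_
    exact ENNReal.toReal_ofReal (vertexMean_nonneg fun _ => Nat.cast_nonneg _)
  have htrunc : Tendsto (fun M : ℕ => ∫ x : GStar, min (F x.degree : ℝ) M ∂μ) atTop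
      (𝓝 (∫ x : GStar, (F x.degree : ℝ) ∂μ)) := by
    refine tendsto_integral_of_dominated_convergence _ (fun M => hmeas fun m => min (F m : ℝ) M)
      hint (fun M => .of_forall fun x => ?_) (.of_forall fun x => ?_)
    · rw [Real.norm_of_nonneg (by positivity)]
      exact min_le_left _ _
    · refine tendsto_const_nhds.congr' ?_
      filter_upwards [eventually_ge_atTop (F x.degree)] with M hM
      exact (min_eq_left (by exact_mod_cast hM)).symm
  -- The truncation loses less than `δ` in the limit, so adding `δ` back will overshoot `𝔼 F(d*)`.
  obtain ⟨M, hM⟩ := (htrunc.eventually (lt_mem_nhds (sub_lt_self _ hδ))).exists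
  have hdeg := hG.tendsto_comp_nat GStar.continuous_degree (g := fun m => min (F m : ℝ) M)
    (C := M) fun m => by
      rw [abs_of_nonneg (by positivity)]
      exact min_le_right _ _
  have hlow := (hdeg.add_const δ).sub (hS.tendsto_div_nhds_zero.mul_const (M : ℝ))
  rw [zero_mul, sub_zero] at hlow
  have hle := le_of_tendsto_of_tendsto hlow hreal (by
    filter_upwards [hlarge] with n hn
    -- On `S` the truncated term is at most `M`, so it can be traded for `F (D n)`; the cost
    -- `M|S|/|V|` vanishes in the limit.
    have hpt : vertexMean (fun v => min (F (deg (G n) v) : ℝ) M +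
        if v ∈ S n then (F (D n) : ℝ) - M else 0) ≤
          vertexMean fun v => (F (deg (G n) v) : ℝ) := by
      refine vertexMean_mono fun v => ?_
      split_ifs with hv
      · have h1 : (F (D n) : ℝ) ≤ F (deg (G n) v) := by exact_mod_cast hF (hD n v hv)
        have h2 := min_le_right (F (deg (G n) v) : ℝ) M
        linarith
      · rw [add_zero]
        exact min_le_left _ _
    rw [vertexMean_add, vertexMean_ite_mem, mul_sub, sub_div] at hpt
    simp only [degree_rootedComponent]
    rw [div_mul_eq_mul_div]
    linarith)
  linarith

end Limits

/-! ### Adding a large clique -/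

section Clique

lemma editedAt_sup_cliqueOn {V : Type} (G : SimpleGraph V) (S : Finset V) :
    EditedAt S G (G ⊔ cliqueOn S) :=
  ⟨fun _ _ h h' => (h' (.inl h)).elim, fun _ _ h h' => (h.resolve_left h').2⟩

lemma card_sub_one_le_deg {V : Type} [Fintype V] (G : SimpleGraph V) {S : Finset V} {v : V}
    (hv : v ∈ S) : S.card - 1 ≤ deg (G ⊔ cliqueOn S) v := by
  classical
  rw [← Finset.card_erase_of_mem hv, ← Set.ncard_coe_finset]
  refine Set.ncard_le_ncard (fun u hu => ?_) (Set.toFinite _)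
  obtain ⟨hne, hu⟩ := Finset.mem_erase.mp hu
  exact .inr ⟨hne.symm, hv, hu⟩

lemma tendsto_atTop_of_rpow_isBigO {s : ℕ → ℕ} {h : ℕ} (hh : h ≠ 0)
    (hs : (fun n : ℕ => (n : ℝ) ^ ((1 : ℝ) / h)) =O[atTop] fun n => (s n : ℝ)) :
    Tendsto s atTop atTop := by
  obtain ⟨C, hC, hCs⟩ := hs.exists_pos
  have hpow : Tendsto (fun n : ℕ => (n : ℝ) ^ ((1 : ℝ) / h)) atTop atTop :=
    (tendsto_rpow_atTop (by positivity)).comp tendsto_natCast_atTop_atTop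
  refine tendsto_natCast_atTop_iff (R := ℝ) |>.mp ?_
  refine tendsto_atTop_mono' _ ?_ (hpow.atTop_div_const hC)
  filter_upwards [hCs.bound] with n hn
  rw [Real.norm_of_nonneg (by positivity), Real.norm_of_nonneg (by positivity)] at hn
  rwa [div_le_iff₀' hC]

/-- If `s n = Ω(n ^ (1 / (k + 1)))`, there are `Ω(n)` injective `(k + 1)`-tuples in a set of
size `s n`. -/
lemma exists_le_mul_descFactorial {s : ℕ → ℕ} {k : ℕ}
    (hs : (fun n : ℕ => (n : ℝ) ^ ((1 : ℝ) / (k + 1 : ℕ))) =O[atTop] fun n => (s n : ℝ)) :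
    ∃ δ : ℝ, 0 < δ ∧ ∀ᶠ n : ℕ in atTop, δ ≤ s n * (s n - 1).descFactorial k / (n : ℝ) := by
  obtain ⟨C, hC, hCs⟩ := hs.exists_pos
  -- `s n ≥ n^(1/(k+1)) / C`, and once `s n ≥ 2(k+1)` each of the `k + 1` factors of the falling
  -- factorial is at least `s n / 2`.
  refine ⟨(1 / (2 * C)) ^ (k + 1), by positivity, ?_⟩
  filter_upwards [hCs.bound, (tendsto_atTop_of_rpow_isBigO k.succ_ne_zero hs).eventually_ge_atTop
    (2 * (k + 1)), eventually_gt_atTop 0] with n hn hsk hn0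
  rw [Real.norm_of_nonneg (by positivity), Real.norm_of_nonneg (by positivity)] at hn
  have hn' : (0 : ℝ) < n := by exact_mod_cast hn0
  rw [le_div_iff₀ hn']
  have hdesc : s n * (s n - 1).descFactorial k = (s n).descFactorial (k + 1) := by
    obtain ⟨m, hm⟩ : ∃ m, s n = m + 1 := ⟨s n - 1, by omega⟩
    rw [hm, Nat.succ_descFactorial_succ, Nat.add_sub_cancel]
  have hroot : ((n : ℝ) ^ ((1 : ℝ) / (k + 1 : ℕ))) ^ (k + 1) = n := by
    rw [one_div, Real.rpow_inv_natCast_pow hn'.le k.succ_ne_zero]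
  have hhalf : (s n : ℝ) / 2 ≤ (s n + 1 - (k + 1) : ℕ) := by
    rw [div_le_iff₀ two_pos]
    exact_mod_cast (by omega : s n ≤ (s n + 1 - (k + 1)) * 2)
  calc (1 / (2 * C)) ^ (k + 1) * (n : ℝ)
      = ((n : ℝ) ^ ((1 : ℝ) / (k + 1 : ℕ)) / (2 * C)) ^ (k + 1) := by
        rw [div_pow, div_pow, hroot, one_pow, one_div_mul_eq_div]
    _ ≤ ((s n : ℝ) / 2) ^ (k + 1) := by
        gcongr ?_ ^ _
        rw [div_le_iff₀ (by positivity)]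
        linarith
    _ ≤ ((s n + 1 - (k + 1) : ℕ) : ℝ) ^ (k + 1) := by gcongr
    _ ≤ ((s n).descFactorial (k + 1) : ℝ) := by
        exact_mod_cast Nat.pow_sub_le_descFactorial (s n) (k + 1)
    _ = s n * (s n - 1).descFactorial k := by exact_mod_cast hdesc.symm

end Clique

end LocalLimit

/-! ### Assembly of the two parts of the theorem -/

theorem mainTheorem8 (V : ℕ → Type) [∀ n, Fintype (V n)] [∀ n, Nonempty (V n)]
    (G : ∀ n, SimpleGraph (V n)) (S : ∀ n, Finset (V n))
    (μ : Measure GStar) [IsProbabilityMeasure μ]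
    (hG : LocalWeakLimit G μ)
    (hS : (fun n => ((S n).card : ℝ)) =o[atTop] fun n => (Fintype.card (V n) : ℝ)) :
    (DegreePowUniformlyIntegrable G 1 →
      ∀ G' : ∀ n, SimpleGraph (V n), (∀ n, EditedAt (S n) (G n) (G' n)) → LocalWeakLimit G' μ) ∧
    (∀ h : ℕ, 2 ≤ h →
      (∀ n, 1 ≤ n → Fintype.card (V n) = n) →
      ∫⁻ x : GStar, (x.degree : ℝ≥0∞) ^ (h - 1) ∂μ < ⊤ →
      ((fun n : ℕ => (n : ℝ) ^ ((1 : ℝ) / h)) =O[atTop] fun n => ((S n).card : ℝ)) →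
      LocalWeakLimit (fun n => G n ⊔ cliqueOn (S n)) μ ∧
      ¬ DegreeMomentsConverge (fun n => G n ⊔ cliqueOn (S n)) μ (h - 1) ∧
      ¬ DegreePowUniformlyIntegrable (fun n => G n ⊔ cliqueOn (S n)) (h - 1) ∧
      ¬ EmbeddingCountsConverge (fun n => G n ⊔ cliqueOn (S n)) μ h) := by
  refine ⟨fun _ G' hE => hG.of_editedAt hS hE, fun h hh hcard hfin hbig => ?_⟩
  have hG' : LocalWeakLimit (fun n => G n ⊔ cliqueOn (S n)) μ :=
    hG.of_editedAt hS fun n => editedAt_sup_cliqueOn (G n) (S n)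
  have hdeg : ∀ n, ∀ v ∈ S n, (S n).card - 1 ≤ deg (G n ⊔ cliqueOn (S n)) v := fun n v hv =>
    card_sub_one_le_deg (G n) hv
  obtain ⟨k, rfl⟩ : ∃ k, h = k + 1 := ⟨h - 1, by omega⟩
  rw [Nat.add_sub_cancel] at hfin ⊢
  have hsize := tendsto_atTop_of_rpow_isBigO k.succ_ne_zero hbig
  obtain ⟨δ, hδ, hδS⟩ := exists_le_mul_descFactorial hbig
  have hdesc : ∀ᶠ n in atTop, δ ≤
      (S n).card * (((S n).card - 1).descFactorial k : ℕ) / (Fintype.card (V n) : ℝ) := by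
    filter_upwards [hδS, eventually_ge_atTop 1] with n hn h1
    rwa [hcard n h1]
  have hpow : ∀ᶠ n in atTop, δ ≤
      (S n).card * ((((S n).card - 1) ^ k : ℕ) : ℝ) / (Fintype.card (V n) : ℝ) := by
    filter_upwards [hdesc] with n hn
    refine hn.trans ?_
    gcongr
    exact Nat.descFactorial_le_pow _ _
  refine ⟨hG', fun hconv => ?_, fun hUI => ?_, fun hconv => ?_⟩
  · refine not_tendsto_of_large_degrees hG' hS (F := fun m => m ^ k)
      (fun a b hab => Nat.pow_le_pow_left hab k) (by simpa using hfin) hdeg hδ hpow ?_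
    simpa [DegreeMomentsConverge] using hconv
  · classical
    obtain ⟨a, ha⟩ := hUI (δ / 2) (by positivity)
    -- Divergence needs `k ≠ 0`, which is where `h ≥ 2` enters. Eventually all of `S n` lies above
    -- the threshold `a`.
    have hpred : Tendsto (fun n => (((S n).card - 1) ^ k : ℕ)) atTop atTop :=
      (tendsto_pow_atTop (by omega)).comp ((tendsto_sub_atTop_nat 1).comp hsize)
    have hpred' := (tendsto_natCast_atTop_atTop (R := ℝ)).comp hpred
    obtain ⟨n, hn, hna⟩ := (hpow.and (hpred'.eventually_gt_atTop a)).exists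
    have hn2 := ha n
    have hle : (S n).card * ((((S n).card - 1) ^ k : ℕ) : ℝ) / (Fintype.card (V n) : ℝ) ≤
        vertexMean (fun v => if a < (deg (G n ⊔ cliqueOn (S n)) v : ℝ) ^ k then
          (deg (G n ⊔ cliqueOn (S n)) v : ℝ) ^ k else 0) := by
      rw [← vertexMean_ite_mem]
      refine vertexMean_mono fun v => ?_
      split_ifs with hv h1 h1
      · exact_mod_cast Nat.pow_le_pow_left (hdeg n v hv) k
      · refine absurd (hna.trans_le ?_) h1
        change ((((S n).card - 1) ^ k : ℕ) : ℝ) ≤ _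
        exact_mod_cast Nat.pow_le_pow_left (hdeg n v hv) k
      · positivity
      · exact le_rfl
    -- Only the decidability instances of the two conditionals need reconciling.
    have hn2' : vertexMean (fun v => if a < (deg (G n ⊔ cliqueOn (S n)) v : ℝ) ^ k then
          (deg (G n ⊔ cliqueOn (S n)) v : ℝ) ^ k else 0) ≤ δ / 2 := by
      convert hn2
    linarith
  · refine not_tendsto_of_large_degrees hG' hS (F := fun m => m.descFactorial k)
      (fun a b hab => Nat.descFactorial_le k hab)
      (lt_of_le_of_lt (lintegral_mono fun x => ?_) hfin) hdeg hδ hdesc ?_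
    · change ((x.degree.descFactorial k : ℕ) : ℝ≥0∞) ≤ (x.degree : ℝ≥0∞) ^ k
      exact_mod_cast Nat.descFactorial_le_pow x.degree k
    -- One rooted graph suffices: the star with `k` leaves, rooted at its centre.
    · have := hconv _ (SimpleGraph.connected_starGraph 0) 0
      simpa [emb_star, embCount_star, vertexMean] using this
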